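/- Let $M$ be a finite-dimensional smooth manifold without boundary, and $\pi\colon TM\to M$ its tangent bundle. Let $J$ be the canonical tangent structure (vertical endomorphism) on $TM$: for $p\in TM$ and $\xi\in T_p(TM)$, $$J\xi=\left.\frac{\mathrm d}{\mathrm dt}\bigl(p+t\,\pi_*\xi\bigr)\right|_{t=0}.$$ Let $\Gamma\in\Omega^1(TM;TTM)$ be a (nonlinear) connection on $TM$, that is, a smooth vector bundle endomorphism of $TTM\to TM$ such that $J\circ\Gamma=J$ and $\Gamma\circ J=-J$. For smooth vector fields $A,B$ on $TM$ let $[A,B]$ be their Lie bracket and put $$[A,B]_\Gamma=[\Gamma A,B]+[A,\Gamma B]-\Gamma[A,B],$$ $$T_\Gamma(A,B)=[\Gamma A,\Gamma B]-\Gamma[\Gamma A,B]-\Gamma[A,\Gamma B]+\Gamma^2[A,B].$$ Then there exists a Lie algebroid structure $(TTM,q,[\![\,,\,]\!])$ on the vector bundle $TTM\to TM$ whose anchor map is $$q=v=\tfrac12(\mathrm{Id}_{TTM}-\Gamma)$$ and whose bracket on smooth vector fields $A,B$ on $TM$ is $$[\![A,B]\!]=\tfrac12\bigl([A,B]-[A,B]_\Gamma\bigr)+\tfrac14T_\Gamma(A,B).$$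 Here a Lie algebroid structure on a smooth vector bundle $V\to N$ consists of a smooth vector bundle map $q\colon V\to TN$ over $N$ (the anchor) and an $\mathbb R$-bilinear, alternating bracket $[\![\,,\,]\!]$ on the smooth sections of $V$ that satisfies the Jacobi identity and the Leibniz rule $[\![A,fB]\!]=f[\![A,B]\!]+(qA)(f)\,B$ for all smooth sections $A,B$ and all $f\in\mathcal C^\infty(N)$. -/

import Mathlib

open Bundle VectorField
open scoped Manifold ContDiff Bundle

noncomputable section

/-! ### Lie algebroids -/

section LieAlgebroid

variable {EB : Type*} [NormedAddCommGroup EB] [NormedSpace ℝ EB]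
  {HB : Type*} [TopologicalSpace HB] (IB : ModelWithCorners ℝ EB HB)
  {B : Type*} [TopologicalSpace B] [ChartedSpace HB B]
  (F : Type*) [NormedAddCommGroup F] [NormedSpace ℝ F]
  (V : B → Type*) [TopologicalSpace (TotalSpace F V)]
  [∀ x, AddCommGroup (V x)] [∀ x, Module ℝ (V x)] [∀ x, TopologicalSpace (V x)]
  [FiberBundle F V] [VectorBundle ℝ F V]

variable {IB F V} in
/-- The product `f A` of a smooth function `f` and a smooth section `A` of a vector bundle. -/
def smoothSMul (f : C^∞⟮IB, B; 𝓘(ℝ, ℝ), ℝ⟯) (A : Cₛ^∞⟮IB; F, V⟯) : Cₛ^∞⟮IB; F, V⟯ where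
  toFun x := f x • A x
  contMDiff_toFun := f.contMDiff.smul_section A.contMDiff

/-- A Lie algebroid structure on the smooth vector bundle `V` (with model fibre `F`) over the
manifold `B`: a smooth vector bundle map `V → TB` over `B` (the anchor), and a Lie bracket on the
real vector space of smooth sections of `V`, related by the Leibniz rule
`⟦A, f C⟧ = f ⟦A, C⟧ + (q A)(f) C`. -/
structure LieAlgebroid [IsManifold IB ∞ B] [∀ x, IsTopologicalAddGroup (V x)]
    [∀ x, ContinuousSMul ℝ (V x)] [ContMDiffVectorBundle ∞ F V IB] where
  /-- the anchor map, as a smooth section of the bundle `Hom(V, TB)` -/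
  anchor : Cₛ^∞⟮IB; F →L[ℝ] EB, fun x : B => V x →L[ℝ] TangentSpace IB x⟯
  /-- the bracket of smooth sections, an `ℝ`-bilinear operation -/
  bracket : Cₛ^∞⟮IB; F, V⟯ →ₗ[ℝ] Cₛ^∞⟮IB; F, V⟯ →ₗ[ℝ] Cₛ^∞⟮IB; F, V⟯
  bracket_self : ∀ A, bracket A A = 0
  jacobi : ∀ A C D,
    bracket A (bracket C D) + bracket C (bracket D A) + bracket D (bracket A C) = 0
  leibniz : ∀ (A C : Cₛ^∞⟮IB; F, V⟯) (f : C^∞⟮IB, B; 𝓘(ℝ, ℝ), ℝ⟯) (x : B),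
    bracket A (smoothSMul f C) x =
      f x • bracket A C x + mvfderiv IB f x (anchor x (A x)) • C x

end LieAlgebroid

/-! ### Contracted bracket and Nijenhuis torsion of a vector-valued one-form -/

section Endomorphisms

variable {E : Type*} [NormedAddCommGroup E] [NormedSpace ℝ E]
  {H : Type*} [TopologicalSpace H] (I : ModelWithCorners ℝ E H)
  {M : Type*} [TopologicalSpace M] [ChartedSpace H M]

/-- The contracted bracket `[X, Y]_N = [N X, Y] + [X, N Y] - N [X, Y]` of two vector fields by
a field `N` of endomorphisms of the tangent spaces. -/
def contractedBracket (N : ∀ x : M, TangentSpace I x →L[ℝ] TangentSpace I x)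
    (X Y : ∀ x : M, TangentSpace I x) (x : M) : TangentSpace I x :=
  mlieBracket I (fun y => N y (X y)) Y x + mlieBracket I X (fun y => N y (Y y)) x
    - N x (mlieBracket I X Y x)

/-- The Nijenhuis torsion
`T_N (X, Y) = [N X, N Y] - N [N X, Y] - N [X, N Y] + N² [X, Y]`. -/
def nijenhuisTorsion (N : ∀ x : M, TangentSpace I x →L[ℝ] TangentSpace I x)
    (X Y : ∀ x : M, TangentSpace I x) (x : M) : TangentSpace I x :=
  mlieBracket I (fun y => N y (X y)) (fun y => N y (Y y)) x
    - N x (mlieBracket I (fun y => N y (X y)) Y x)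
    - N x (mlieBracket I X (fun y => N y (Y y)) x)
    + N x (N x (mlieBracket I X Y x))

end Endomorphisms

/-! ### The canonical tangent structure of `TM` and nonlinear connections -/

section TangentStructure

variable {E : Type*} [NormedAddCommGroup E] [NormedSpace ℝ E]
  {H : Type*} [TopologicalSpace H] (I : ModelWithCorners ℝ E H)
  {M : Type*} [TopologicalSpace M] [ChartedSpace H M] [IsManifold I ∞ M]

/-- The vertical lift `w ↦ ι(p, w) = d/dt (p + t w)` at `t = 0`, from `T_{π(p)} M` to `T_p (TM)`,
i.e. the derivative at `p` of the inclusion `u ↦ (π(p), u)` of the fibre `T_{π(p)} M` (a vector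
space, identified with its own tangent spaces) into `TM`. -/
def verticalLift (p : TangentBundle I M) :
    TangentSpace I p.proj →L[ℝ] TangentSpace I.tangent p :=
  mfderiv 𝓘(ℝ, E) I.tangent (fun u : E => (⟨p.proj, u⟩ : TangentBundle I M)) p.snd

/-- The vertical endomorphism (canonical tangent structure) `J = ι ∘ j` of `TM`, where
`j ξ = (τ ξ, π_* ξ)`; so `J ξ = ι(p, π_* ξ)` for `ξ ∈ T_p (TM)`. -/
def verticalEndomorphism (p : TangentBundle I M) :
    TangentSpace I.tangent p →L[ℝ] TangentSpace I.tangent p :=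
  (verticalLift I p).comp
    (mfderiv I.tangent I (fun q : TangentBundle I M => q.proj) p)

/-- Vector-valued one-forms `Ω¹(TM; TTM)`: smooth bundle endomorphisms of `TTM → TM`. -/
abbrev TangentEndomorphism (M : Type*) [TopologicalSpace M] [ChartedSpace H M]
    [IsManifold I ∞ M] : Type _ :=
  Cₛ^∞⟮I.tangent; (E × E) →L[ℝ] (E × E),
    fun p : TangentBundle I M => TangentSpace I.tangent p →L[ℝ] TangentSpace I.tangent p⟯

variable {I} in
/-- A (nonlinear) connection on `TM` is a `Γ ∈ Ω¹(TM; TTM)` with `J ∘ Γ = J` and `Γ ∘ J = -J`. -/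
structure IsNonlinearConnection (Γ : TangentEndomorphism I M) :
    Prop where
  comp_left : ∀ p : TangentBundle I M,
    (verticalEndomorphism I p).comp (Γ p) = verticalEndomorphism I p
  comp_right : ∀ p : TangentBundle I M,
    (Γ p).comp (verticalEndomorphism I p) = -verticalEndomorphism I p

end TangentStructure

end

noncomputable section

/-! ### Twisting a Lie bracket by an involution -/

section Algebra

variable {L : Type*} [LieRing L] [LieAlgebra ℝ L]

/-! The conditions on `Γ` say that `v = ½(1 - Γ)` is a projection onto the vertical bundle `ker
π_*`: `JΓ = J` puts its values in `ker J = ker π_*`, and `ΓJ = -J` makes it the identity on `im J =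
ker π_*`. With `h = 1 - v` the bracket collapses to `[vA, vB] + h[vA, B] + h[A, vB]`
(`twistedBracket_eq_of_projection`). Since vertical fields are closed under the bracket
(`mfderiv_proj_mlieBracket`), this is the semidirect product of the vertical fields with the
horizontal ones, taken as abelian, under the flat Bott action `h[vA, hB]`. Jacobi is then pure
algebra (`twistedBracket_jacobi`), and Leibniz follows from `hv = 0`. Involutivity is checked in
induced charts of `TM`, where vertical means zero first component. -/

/-- The bracket `½ ([x, y] - [x, y]_N) + ¼ T_N (x, y)` on a Lie algebra with an endomorphism `N`,
where `[x, y]_N` is the contracted bracket and `T_N` the Nijenhuis torsion. -/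
def twistedBracket (N : L →ₗ[ℝ] L) : L →ₗ[ℝ] L →ₗ[ℝ] L :=
  LinearMap.mk₂ ℝ
    (fun x y => (1 / 2 : ℝ) • (⁅x, y⁆ - (⁅N x, y⁆ + ⁅x, N y⁆ - N ⁅x, y⁆)) +
      (1 / 4 : ℝ) • (⁅N x, N y⁆ - N ⁅N x, y⁆ - N ⁅x, N y⁆ + N (N ⁅x, y⁆)))
    (fun x x' y => by simp only [map_add, add_lie]; module)
    (fun c x y => by simp only [map_smul, smul_lie]; module)
    (fun x y y' => by simp only [map_add, lie_add]; module)
    (fun c x y => by simp only [map_smul, lie_smul]; module)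

theorem twistedBracket_apply (N : L →ₗ[ℝ] L) (x y : L) :
    twistedBracket N x y = (1 / 2 : ℝ) • (⁅x, y⁆ - (⁅N x, y⁆ + ⁅x, N y⁆ - N ⁅x, y⁆)) +
      (1 / 4 : ℝ) • (⁅N x, N y⁆ - N ⁅N x, y⁆ - N ⁅x, N y⁆ + N (N ⁅x, y⁆)) :=
  rfl

theorem twistedBracket_self (N : L →ₗ[ℝ] L) (x : L) : twistedBracket N x x = 0 := by
  rw [twistedBracket_apply, ← lie_skew (N x) x]
  simp only [lie_self, map_neg, map_zero]
  module

/-- In terms of the projection `v = ½ (1 - N)`, the twisted bracket of an involution `N` is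
`[v x, v y] + h [v x, y] + h [x, v y]` with `h = 1 - v`. -/
theorem twistedBracket_eq_of_projection {N v : L →ₗ[ℝ] L} (hN : ∀ x, N x = x - (2 : ℝ) • v x)
    (hv : ∀ x, v (v x) = v x) (x y : L) :
    twistedBracket N x y =
      ⁅v x, v y⁆ + (⁅v x, y⁆ - v ⁅v x, y⁆) + (⁅x, v y⁆ - v ⁅x, v y⁆) := by
  simp only [twistedBracket_apply, hN, map_sub, map_smul, sub_lie, lie_sub, smul_lie, lie_smul, hv]
  module

/-- The twisted bracket satisfies the Jacobi identity when the image of the projection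
`v = ½ (1 - N)` is a Lie subalgebra. -/
theorem twistedBracket_jacobi {N v : L →ₗ[ℝ] L} (hN : ∀ x, N x = x - (2 : ℝ) • v x)
    (hv : ∀ x, v (v x) = v x) (hlie : ∀ x y, v ⁅v x, v y⁆ = ⁅v x, v y⁆) (x y z : L) :
    twistedBracket N x (twistedBracket N y z) + twistedBracket N y (twistedBracket N z x) +
      twistedBracket N z (twistedBracket N x y) = 0 := by
  -- So `v` is a homomorphism to the original bracket.
  have hvB : ∀ x y, v (twistedBracket N x y) = ⁅v x, v y⁆ := fun x y => by
    simp only [twistedBracket_eq_of_projection hN hv, map_add, map_sub, hv, hlie]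
    abel
  -- The Bott action `h[v x, w]` sees `w` only modulo the image of `v`, by `hlie`.
  have hh : ∀ x w, ⁅v x, w - v w⁆ - v ⁅v x, w - v w⁆ = ⁅v x, w⁆ - v ⁅v x, w⁆ := fun x w => by
    simp only [lie_sub, map_sub, hlie]
    abel
  have key : ∀ x y z, twistedBracket N x (twistedBracket N y z) = ⁅v x, ⁅v y, v z⁆⁆ +
      (⁅v x, ⁅v y, z⁆⁆ - v ⁅v x, ⁅v y, z⁆⁆) + (⁅v x, ⁅y, v z⁆⁆ - v ⁅v x, ⁅y, v z⁆⁆) +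
      (⁅x, ⁅v y, v z⁆⁆ - v ⁅x, ⁅v y, v z⁆⁆) := fun x y z => by
    rw [twistedBracket_eq_of_projection hN hv x, hvB, twistedBracket_eq_of_projection hN hv y,
      ← hh x ⁅v y, z⁆, ← hh x ⁅y, v z⁆]
    have := hlie x ⁅v y, v z⁆
    rw [hlie y z] at this
    simp only [lie_add, map_add, this]
    abel
  have J := lie_jacobi (v x) (v y) (v z)
  have J₁ := lie_jacobi x (v y) (v z)
  have J₂ := lie_jacobi (v x) y (v z)
  have J₃ := lie_jacobi (v x) (v y) z
  have V₁ := congrArg v J₁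
  have V₂ := congrArg v J₂
  have V₃ := congrArg v J₃
  simp only [map_add, map_zero] at V₁ V₂ V₃
  rw [key, key, key]
  -- `J` is the vertical part; each `Jᵢ - Vᵢ` is `h` applied to a Jacobi identity with one
  -- unprojected entry.
  linear_combination (norm := module) J + J₁ + J₂ + J₃ - V₁ - V₂ - V₃

end Algebra

/-! ### The Lie algebra of smooth vector fields -/

section VectorFields

variable {E : Type*} [NormedAddCommGroup E] [NormedSpace ℝ E]
  {H : Type*} [TopologicalSpace H] {I : ModelWithCorners ℝ E H}
  {M : Type*} [TopologicalSpace M] [ChartedSpace H M] [IsManifold I ∞ M]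

theorem mdifferentiableAt_vectorField
    (A : Cₛ^∞⟮I; E, fun x : M => TangentSpace I x⟯) (x : M) :
    MDifferentiableAt I I.tangent (fun y => (⟨y, A y⟩ : TangentBundle I M)) x :=
  A.contMDiff.mdifferentiable (by simp) x

/-- The action of a smooth field of endomorphisms of the tangent spaces on smooth vector fields. -/
def endomorphismAction
    (N : Cₛ^∞⟮I; E →L[ℝ] E, fun x : M => TangentSpace I x →L[ℝ] TangentSpace I x⟯) :
    Cₛ^∞⟮I; E, fun x : M => TangentSpace I x⟯ →ₗ[ℝ]
      Cₛ^∞⟮I; E, fun x : M => TangentSpace I x⟯ where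
  toFun A :=
    { toFun := fun x => N x (A x)
      contMDiff_toFun := N.contMDiff.clm_bundle_apply A.contMDiff }
  map_add' A B := by
    ext x
    exact map_add (N x) (A x) (B x)
  map_smul' c A := by
    ext x
    exact map_smul (N x) c (A x)

theorem endomorphismAction_apply
    (N : Cₛ^∞⟮I; E →L[ℝ] E, fun x : M => TangentSpace I x →L[ℝ] TangentSpace I x⟯)
    (A : Cₛ^∞⟮I; E, fun x : M => TangentSpace I x⟯) (x : M) :
    endomorphismAction N A x = N x (A x) :=
  rfl

theorem endomorphismAction_smoothSMul
    (N : Cₛ^∞⟮I; E →L[ℝ] E, fun x : M => TangentSpace I x →L[ℝ] TangentSpace I x⟯)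
    (A : Cₛ^∞⟮I; E, fun x : M => TangentSpace I x⟯) (f : C^∞⟮I, M; 𝓘(ℝ, ℝ), ℝ⟯) :
    endomorphismAction N (smoothSMul f A) = smoothSMul f (endomorphismAction N A) := by
  ext x
  exact map_smul (N x) (f x) (A x)

/-- The identity endomorphism field is smooth. -/
def identityEndomorphism :
    Cₛ^∞⟮I; E →L[ℝ] E, fun x : M => TangentSpace I x →L[ℝ] TangentSpace I x⟯ where
  toFun x := ContinuousLinearMap.id ℝ (TangentSpace I x)
  contMDiff_toFun := by
    intro x
    refine (contMDiffAt_hom_bundle _).2 ⟨contMDiffAt_id, ?_⟩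
    -- In the trivialization at `x` the identity reads as a constant map over the base set.
    refine (contMDiffAt_const (c := ContinuousLinearMap.id ℝ E)).congr_of_eventuallyEq ?_
    have hx : (trivializationAt E (fun y : M => TangentSpace I y) x).baseSet ∈ nhds x :=
      (trivializationAt E (fun y : M => TangentSpace I y) x).open_baseSet.mem_nhds
        (FiberBundle.mem_baseSet_trivializationAt' x)
    filter_upwards [hx] with y hy
    ext u
    exact (trivializationAt E (fun y : M => TangentSpace I y) x).continuousLinearMapAt_symmL hy u

variable [CompleteSpace E]

/-- The Lie bracket of smooth vector fields, as a smooth vector field. -/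
def vectorFieldLie (A B : Cₛ^∞⟮I; E, fun x : M => TangentSpace I x⟯) :
    Cₛ^∞⟮I; E, fun x : M => TangentSpace I x⟯ where
  toFun := mlieBracket I A B
  contMDiff_toFun := by
    have : IsManifold I (((⊤ : ℕ∞) : WithTop ℕ∞) + 1) M := ‹IsManifold I ∞ M›
    have : IsManifold I (minSmoothness ℝ 2) M := .of_le (n := ∞) (by simpa using ENat.LEInfty.out)
    exact ContDiff.mlieBracket_vectorField (n := ⊤) (m := ⊤) A.contMDiff B.contMDiff (by simp)

/-- Smooth vector fields form a Lie ring. -/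
instance vectorFieldLieRing : LieRing Cₛ^∞⟮I; E, fun x : M => TangentSpace I x⟯ where
  bracket := vectorFieldLie
  add_lie A B C := by
    ext x
    exact mlieBracket_add_left (mdifferentiableAt_vectorField A x)
      (mdifferentiableAt_vectorField B x)
  lie_add A B C := by
    ext x
    exact mlieBracket_add_right (mdifferentiableAt_vectorField B x)
      (mdifferentiableAt_vectorField C x)
  lie_self A := by
    ext x
    exact congrFun (mlieBracket_self (I := I) (V := A)) x
  leibniz_lie A B C := by
    have h : minSmoothness ℝ 2 ≤ ∞ := by simpa using ENat.LEInfty.out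
    have : IsManifold I (minSmoothness ℝ 3) M := .of_le (n := ∞) (by simpa using ENat.LEInfty.out)
    ext x
    exact leibniz_identity_mlieBracket_apply ((A.contMDiff x).of_le h) ((B.contMDiff x).of_le h)
      ((C.contMDiff x).of_le h)

/-- Smooth vector fields form a real Lie algebra. -/
instance vectorFieldLieAlgebra : LieAlgebra ℝ Cₛ^∞⟮I; E, fun x : M => TangentSpace I x⟯ where
  lie_smul c A B := by
    ext x
    exact mlieBracket_const_smul_right (mdifferentiableAt_vectorField B x)

theorem lie_smoothSMul_apply (A B : Cₛ^∞⟮I; E, fun x : M => TangentSpace I x⟯)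
    (f : C^∞⟮I, M; 𝓘(ℝ, ℝ), ℝ⟯) (x : M) :
    ⁅A, smoothSMul f B⁆ x = f x • ⁅A, B⁆ x + mvfderiv I f x (A x) • B x := by
  rw [add_comm]
  exact mlieBracket_smul_right f.mdifferentiableAt (mdifferentiableAt_vectorField B x)

end VectorFields

/-! ### The vertical bundle of `TM` -/

section VerticalBundle

variable {E : Type*} [NormedAddCommGroup E] [NormedSpace ℝ E]
  {H : Type*} [TopologicalSpace H] {I : ModelWithCorners ℝ E H}
  {M : Type*} [TopologicalSpace M] [ChartedSpace H M] [IsManifold I ∞ M]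

/-- In charts of `TM` induced by charts of `M`, the differential of the projection is the first
projection. -/
theorem fst_mfderiv_extChartAt_tangent (p q : TangentBundle I M)
    (hq : q.proj ∈ (chartAt H p.proj).source) (ξ : TangentSpace I.tangent q) :
    Prod.fst (α := E) (β := E) (mfderiv I.tangent 𝓘(ℝ, E × E) (extChartAt I.tangent p) q ξ) =
      mfderiv I 𝓘(ℝ, E) (extChartAt I p.proj) q.proj
        (mfderiv I.tangent I (fun r : TangentBundle I M => r.proj) q ξ) := by
  have hq' : q ∈ (chartAt (ModelProd H E) p).source := by simpa using hq
  have h₁ : MDifferentiableAt I.tangent 𝓘(ℝ, E × E) (extChartAt I.tangent p) q :=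
    mdifferentiableAt_extChartAt hq'
  have h₂ : MDifferentiableAt I 𝓘(ℝ, E) (extChartAt I p.proj) q.proj :=
    mdifferentiableAt_extChartAt hq
  have h₃ : MDifferentiableAt I.tangent I (fun r : TangentBundle I M => r.proj) q :=
    mdifferentiableAt_proj (TangentSpace I)
  have h₄ : MDifferentiableAt 𝓘(ℝ, E × E) 𝓘(ℝ, E) (Prod.fst : E × E → E)
      (extChartAt I.tangent p q) := differentiableAt_fst.mdifferentiableAt
  -- Charts of `TM` cover those of `M`; the claim is the derivative of this square.
  have e : (Prod.fst : E × E → E) ∘ extChartAt I.tangent p =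
      extChartAt I p.proj ∘ fun r : TangentBundle I M => r.proj := rfl
  have h := mfderiv_comp q h₄ h₁
  rw [e, mfderiv_comp q h₂ h₃, mfderiv_eq_fderiv, fderiv_fst] at h
  exact (DFunLike.congr_fun h ξ).symm

/-- In the chart of `TM` at `p`, the vertical lift is the inclusion of the second factor. -/
theorem mfderiv_extChartAt_tangent_verticalLift (p : TangentBundle I M)
    (w : TangentSpace I p.proj) :
    mfderiv I.tangent 𝓘(ℝ, E × E) (extChartAt I.tangent p) p (verticalLift I p w) =
      ((0, w) : E × E) := by
  have h₁ : MDifferentiableAt I.tangent 𝓘(ℝ, E × E) (extChartAt I.tangent p) p :=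
    mdifferentiableAt_extChartAt (mem_chart_source _ p)
  -- The coordinate change from a chart to itself is the identity, so the chart at `p` is `u ↦
  -- (const, u)` on this fibre.
  have e₀ : ∀ u : E, (trivializationAt E (TangentSpace I) p.proj
      (⟨p.proj, u⟩ : TangentBundle I M)).2 = u := fun u =>
    tangentCoordChange_self (mem_extChartAt_source p.proj)
  have h₂ : MDifferentiableAt 𝓘(ℝ, E) I.tangent
      (fun u : E => (⟨p.proj, u⟩ : TangentBundle I M)) p.snd := by
    refine (mdifferentiableAt_totalSpace I _).2 ⟨mdifferentiableAt_const, ?_⟩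
    simp only [e₀]
    exact mdifferentiableAt_id
  have e : extChartAt I.tangent p ∘ (fun u : E => (⟨p.proj, u⟩ : TangentBundle I M)) =
      fun u : E => (extChartAt I p.proj p.proj, u) := by
    funext u
    exact Prod.ext rfl (e₀ u)
  have h := mfderiv_comp (M := E) (f := fun u : E => (⟨p.proj, u⟩ : TangentBundle I M)) p.snd h₁ h₂
  rw [e] at h
  have h₃ : HasMFDerivAt 𝓘(ℝ, E) 𝓘(ℝ, E × E) (fun u : E => (extChartAt I p.proj p.proj, u))
      p.snd (ContinuousLinearMap.inr ℝ E E) :=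
    (hasFDerivAt_prodMk_right (extChartAt I p.proj p.proj) (show E from p.snd)).hasMFDerivAt
  exact (DFunLike.congr_fun (h.symm.trans h₃.mfderiv) w)

theorem mfderiv_extChartAt_tangent_injective (p : TangentBundle I M) :
    Function.Injective (mfderiv I.tangent 𝓘(ℝ, E × E) (extChartAt I.tangent p) p) :=
  (isInvertible_mfderiv_extChartAt (mem_extChartAt_source p)).injective

theorem verticalLift_injective (p : TangentBundle I M) :
    Function.Injective (verticalLift I p) := by
  intro w w' h
  have := congrArg (mfderiv I.tangent 𝓘(ℝ, E × E) (extChartAt I.tangent p) p) h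
  rw [mfderiv_extChartAt_tangent_verticalLift, mfderiv_extChartAt_tangent_verticalLift] at this
  exact congrArg (fun z : E × E => z.2) this

theorem verticalEndomorphism_eq_zero_iff (p : TangentBundle I M) (ξ : TangentSpace I.tangent p) :
    verticalEndomorphism I p ξ = 0 ↔
      mfderiv I.tangent I (fun r : TangentBundle I M => r.proj) p ξ = 0 :=
  map_eq_zero_iff (verticalLift I p) (verticalLift_injective p)

/-- In charts `π_*` is the first projection, so a chart vector with zero second component serves as
the lift. -/
theorem exists_mfderiv_proj_eq (p : TangentBundle I M) (w : TangentSpace I p.proj) :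
    ∃ ξ : TangentSpace I.tangent p,
      mfderiv I.tangent I (fun r : TangentBundle I M => r.proj) p ξ = w := by
  obtain ⟨ξ, hξ⟩ := (isInvertible_mfderiv_extChartAt (I := I.tangent)
    (mem_extChartAt_source p)).surjective
      ((mfderiv I 𝓘(ℝ, E) (extChartAt I p.proj) p.proj w, 0) : E × E)
  refine ⟨ξ, (isInvertible_mfderiv_extChartAt (I := I) (mem_extChartAt_source p.proj)).injective ?_⟩
  rw [← fst_mfderiv_extChartAt_tangent p p (mem_chart_source H p.proj)]
  exact congrArg (fun z : E × E => z.1) hξ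

/-- A tangent vector killed by the differential of the projection is in the image of `J`. -/
theorem exists_verticalEndomorphism_eq (p : TangentBundle I M) (ξ : TangentSpace I.tangent p)
    (hξ : mfderiv I.tangent I (fun r : TangentBundle I M => r.proj) p ξ = 0) :
    ∃ η, verticalEndomorphism I p η = ξ := by
  -- In the chart `ξ` is `(0, b)`, which is the vertical lift of `b`; `η` is any lift of `b` through
  -- `π_*`.
  obtain ⟨η, hη⟩ := exists_mfderiv_proj_eq p
    (Prod.snd (α := E) (β := E) (mfderiv I.tangent 𝓘(ℝ, E × E) (extChartAt I.tangent p) p ξ))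
  refine ⟨η, mfderiv_extChartAt_tangent_injective p ?_⟩
  have h₁ := fst_mfderiv_extChartAt_tangent p p (mem_chart_source H p.proj) ξ
  rw [hξ, map_zero] at h₁
  have h₂ : verticalEndomorphism I p η = verticalLift I p
      (Prod.snd (α := E) (β := E) (mfderiv I.tangent 𝓘(ℝ, E × E) (extChartAt I.tangent p) p ξ)) :=
    congrArg (verticalLift I p) hη
  rw [h₂]
  exact (mfderiv_extChartAt_tangent_verticalLift p _).trans (Prod.ext h₁.symm rfl)

/-- A vector field on `TM` read in the chart at `p`. -/
def vectorFieldInChart (p : TangentBundle I M)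
    (Z : ∀ q : TangentBundle I M, TangentSpace I.tangent q) : E × E → E × E :=
  mpullbackWithin 𝓘(ℝ, E × E) I.tangent (extChartAt I.tangent p).symm Z (Set.range I.tangent)

/-- Needed on the whole target, since chart components are differentiated later. -/
theorem vectorFieldInChart_apply (p : TangentBundle I M)
    (Z : ∀ q : TangentBundle I M, TangentSpace I.tangent q) {z : E × E}
    (hz : z ∈ (extChartAt I.tangent p).target) :
    vectorFieldInChart p Z z =
      mfderiv I.tangent 𝓘(ℝ, E × E) (extChartAt I.tangent p)
        ((extChartAt I.tangent p).symm z) (Z ((extChartAt I.tangent p).symm z)) := by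
  have h : (mfderivWithin 𝓘(ℝ, E × E) I.tangent (extChartAt I.tangent p).symm
      (Set.range I.tangent) z).inverse =
        mfderiv I.tangent 𝓘(ℝ, E × E) (extChartAt I.tangent p)
          ((extChartAt I.tangent p).symm z) := by
    apply ContinuousLinearMap.inverse_eq
    · exact mfderivWithin_extChartAt_symm_comp_mfderiv_extChartAt hz
    · exact mfderiv_extChartAt_comp_mfderivWithin_extChartAt_symm hz
  exact DFunLike.congr_fun h _

variable [I.Boundaryless]

/-- The manifold bracket is defined through the chart at `p`; without boundary, derivatives within
the range are ordinary ones. -/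
theorem lieBracket_vectorFieldInChart (X Y : ∀ q : TangentBundle I M, TangentSpace I.tangent q)
    (p : TangentBundle I M) :
    lieBracket ℝ (vectorFieldInChart p X) (vectorFieldInChart p Y) (extChartAt I.tangent p p) =
      mfderiv I.tangent 𝓘(ℝ, E × E) (extChartAt I.tangent p) p (mlieBracket I.tangent X Y p) := by
  rw [← lieBracketWithin_univ, ← I.tangent.range_eq_univ, ← mlieBracketWithin_univ,
    mlieBracketWithin_apply, Set.preimage_univ, Set.univ_inter]
  exact ((isInvertible_mfderiv_extChartAt (mem_extChartAt_source p)).inverse_apply_eq.1 rfl)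

variable [CompleteSpace E]

theorem differentiableAt_vectorFieldInChart (Z : Cₛ^∞⟮I.tangent; E × E,
      fun p : TangentBundle I M => TangentSpace I.tangent p⟯) (p : TangentBundle I M) :
    DifferentiableAt ℝ (vectorFieldInChart p Z) (extChartAt I.tangent p p) := by
  have h : DifferentiableWithinAt ℝ (vectorFieldInChart p Z)
      ((extChartAt I.tangent p).symm ⁻¹' Set.univ ∩ Set.range I.tangent)
      (extChartAt I.tangent p p) :=
    MDifferentiableWithinAt.differentiableWithinAt_mpullbackWithin_vectorField
      (mdifferentiableAt_vectorField Z p).mdifferentiableWithinAt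
  rwa [Set.preimage_univ, Set.univ_inter, I.tangent.range_eq_univ,
    differentiableWithinAt_univ] at h

/-- The first component of a vertical vector field in a chart has vanishing derivative. -/
theorem fst_fderiv_vectorFieldInChart (Z : Cₛ^∞⟮I.tangent; E × E,
      fun p : TangentBundle I M => TangentSpace I.tangent p⟯)
    (hZ : ∀ p, mfderiv I.tangent I (fun r : TangentBundle I M => r.proj) p (Z p) = 0)
    (p : TangentBundle I M) (w : E × E) :
    (fderiv ℝ (vectorFieldInChart p Z) (extChartAt I.tangent p p) w).1 = 0 := by
  have hz : (fun z => (vectorFieldInChart p Z z).1) =ᶠ[nhds (extChartAt I.tangent p p)]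
      fun _ => 0 := by
    filter_upwards [extChartAt_target_mem_nhds (I := I.tangent) p] with z hz
    have hs : ((extChartAt I.tangent p).symm z).proj ∈ (chartAt H p.proj).source := by
      have := (extChartAt I.tangent p).map_target hz
      rwa [extChartAt_source, TangentBundle.mem_chart_source_iff] at this
    rw [vectorFieldInChart_apply p Z hz]
    refine (fst_mfderiv_extChartAt_tangent p _ hs _).trans ?_
    rw [hZ]
    exact map_zero _
  have h := hz.fderiv_eq (𝕜 := ℝ)
  rw [fderiv.fst (differentiableAt_vectorFieldInChart Z p), fderiv_fun_const] at h
  exact DFunLike.congr_fun h w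

/-- The vertical bundle of `TM` is involutive. -/
theorem mfderiv_proj_mlieBracket (X Y : Cₛ^∞⟮I.tangent; E × E,
      fun p : TangentBundle I M => TangentSpace I.tangent p⟯)
    (hX : ∀ p, mfderiv I.tangent I (fun r : TangentBundle I M => r.proj) p (X p) = 0)
    (hY : ∀ p, mfderiv I.tangent I (fun r : TangentBundle I M => r.proj) p (Y p) = 0)
    (p : TangentBundle I M) :
    mfderiv I.tangent I (fun r : TangentBundle I M => r.proj) p
      (mlieBracket I.tangent X Y p) = 0 := by
  refine (isInvertible_mfderiv_extChartAt (I := I) (mem_extChartAt_source p.proj)).injective ?_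
  rw [map_zero, ← fst_mfderiv_extChartAt_tangent p p (mem_chart_source H p.proj),
    ← lieBracket_vectorFieldInChart]
  -- In the chart the bracket is `DY·X - DX·Y`, and both terms have zero first component.
  exact (congrArg₂ (· - ·) (fst_fderiv_vectorFieldInChart Y hY p _)
    (fst_fderiv_vectorFieldInChart X hX p _)).trans (sub_zero 0)

end VerticalBundle

/-! ### Nonlinear connections -/

section NonlinearConnection

variable {E : Type*} [NormedAddCommGroup E] [NormedSpace ℝ E]
  {H : Type*} [TopologicalSpace H] {I : ModelWithCorners ℝ E H}
  {M : Type*} [TopologicalSpace M] [ChartedSpace H M] [IsManifold I ∞ M]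

/-- The vertical projection `v = ½ (Id - Γ)` of a vector-valued one-form `Γ` on `TM`. -/
def verticalProjection (Γ : TangentEndomorphism I M) : TangentEndomorphism I M :=
  (1 / 2 : ℝ) • (identityEndomorphism - Γ)

theorem verticalProjection_apply_apply (Γ : TangentEndomorphism I M) (p : TangentBundle I M)
    (ξ : TangentSpace I.tangent p) :
    verticalProjection Γ p ξ = (1 / 2 : ℝ) • (ξ - Γ p ξ) :=
  rfl

theorem endomorphismAction_eq_sub (Γ : TangentEndomorphism I M)
    (A : Cₛ^∞⟮I.tangent; E × E, fun p : TangentBundle I M => TangentSpace I.tangent p⟯) :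
    endomorphismAction Γ A = A - (2 : ℝ) • endomorphismAction (verticalProjection Γ) A := by
  ext p
  change Γ p (A p) = A p - (2 : ℝ) • (1 / 2 : ℝ) • (A p - Γ p (A p))
  module

namespace IsNonlinearConnection

variable {Γ : TangentEndomorphism I M} (hΓ : IsNonlinearConnection Γ)
include hΓ

/-- The projection `v` takes values in the vertical bundle. -/
theorem mfderiv_proj_verticalProjection (p : TangentBundle I M) (ξ : TangentSpace I.tangent p) :
    mfderiv I.tangent I (fun r : TangentBundle I M => r.proj) p (verticalProjection Γ p ξ) = 0 := by
  rw [← verticalEndomorphism_eq_zero_iff, verticalProjection_apply_apply, map_smul, map_sub]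
  have h : verticalEndomorphism I p (Γ p ξ) = verticalEndomorphism I p ξ :=
    DFunLike.congr_fun (hΓ.comp_left p) ξ
  rw [h, sub_self, smul_zero]

/-- The projection `v` is the identity on the vertical bundle. -/
theorem verticalProjection_eq_self (p : TangentBundle I M) (ξ : TangentSpace I.tangent p)
    (hξ : mfderiv I.tangent I (fun r : TangentBundle I M => r.proj) p ξ = 0) :
    verticalProjection Γ p ξ = ξ := by
  obtain ⟨η, rfl⟩ := exists_verticalEndomorphism_eq p ξ hξ
  have h : Γ p (verticalEndomorphism I p η) = -verticalEndomorphism I p η :=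
    DFunLike.congr_fun (hΓ.comp_right p) η
  rw [verticalProjection_apply_apply, h]
  module

theorem verticalProjection_idem
    (A : Cₛ^∞⟮I.tangent; E × E, fun p : TangentBundle I M => TangentSpace I.tangent p⟯) :
    endomorphismAction (verticalProjection Γ) (endomorphismAction (verticalProjection Γ) A) =
      endomorphismAction (verticalProjection Γ) A := by
  ext p
  exact hΓ.verticalProjection_eq_self p _ (hΓ.mfderiv_proj_verticalProjection p (A p))

variable [CompleteSpace E]

/-- The derivative terms are `(vA)(f) vB`, `(vA)(f) hB` and `A(f) h(vB)`; the last is zero and the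
others add up to `(vA)(f) B`. -/
theorem twistedBracket_leibniz
    (A B : Cₛ^∞⟮I.tangent; E × E, fun p : TangentBundle I M => TangentSpace I.tangent p⟯)
    (f : C^∞⟮I.tangent, TangentBundle I M; 𝓘(ℝ, ℝ), ℝ⟯) (p : TangentBundle I M) :
    twistedBracket (endomorphismAction Γ) A (smoothSMul f B) p =
      f p • twistedBracket (endomorphismAction Γ) A B p +
        mvfderiv I.tangent f p (verticalProjection Γ p (A p)) • B p := by
  rw [twistedBracket_eq_of_projection (endomorphismAction_eq_sub Γ) hΓ.verticalProjection_idem,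
    twistedBracket_eq_of_projection (endomorphismAction_eq_sub Γ) hΓ.verticalProjection_idem,
    endomorphismAction_smoothSMul]
  have hv := congrArg (fun Z => Z p) (hΓ.verticalProjection_idem B)
  simp only [ContMDiffSection.coe_add, ContMDiffSection.coe_sub, Pi.add_apply, Pi.sub_apply,
    endomorphismAction_apply, lie_smoothSMul_apply, map_add, map_smul] at hv ⊢
  rw [hv]
  module

variable [I.Boundaryless]

theorem verticalProjection_lie
    (A B : Cₛ^∞⟮I.tangent; E × E, fun p : TangentBundle I M => TangentSpace I.tangent p⟯) :
    endomorphismAction (verticalProjection Γ) ⁅endomorphismAction (verticalProjection Γ) A,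
        endomorphismAction (verticalProjection Γ) B⁆ =
      ⁅endomorphismAction (verticalProjection Γ) A,
        endomorphismAction (verticalProjection Γ) B⁆ := by
  ext p
  exact hΓ.verticalProjection_eq_self p _ (mfderiv_proj_mlieBracket _ _
    (fun q => hΓ.mfderiv_proj_verticalProjection q (A q))
    (fun q => hΓ.mfderiv_proj_verticalProjection q (B q)) p)

/-- The Lie algebroid `(TTM, v, ⟦·,·⟧)` of a nonlinear connection. -/
def lieAlgebroid : LieAlgebroid I.tangent (E × E)
    (fun p : TangentBundle I M => TangentSpace I.tangent p) where
  anchor := verticalProjection Γ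
  bracket := twistedBracket (endomorphismAction Γ)
  bracket_self := twistedBracket_self _
  jacobi := twistedBracket_jacobi (endomorphismAction_eq_sub Γ) hΓ.verticalProjection_idem
    hΓ.verticalProjection_lie
  leibniz := hΓ.twistedBracket_leibniz

end IsNonlinearConnection

end NonlinearConnection

end

theorem mainTheorem5
    {E : Type*} [NormedAddCommGroup E] [NormedSpace ℝ E] [FiniteDimensional ℝ E]
    {H : Type*} [TopologicalSpace H] (I : ModelWithCorners ℝ E H) [I.Boundaryless]
    {M : Type*} [TopologicalSpace M] [ChartedSpace H M] [IsManifold I ∞ M]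
    (Γ : TangentEndomorphism I M) (hΓ : IsNonlinearConnection Γ) :
    ∃ 𝓛 : LieAlgebroid I.tangent (E × E)
        (fun p : TangentBundle I M => TangentSpace I.tangent p),
      (∀ p : TangentBundle I M,
        𝓛.anchor p =
          (1 / 2 : ℝ) • (ContinuousLinearMap.id ℝ (TangentSpace I.tangent p) - Γ p)) ∧
      ∀ (A B : Cₛ^∞⟮I.tangent; E × E,
          fun p : TangentBundle I M => TangentSpace I.tangent p⟯) (p : TangentBundle I M),
        𝓛.bracket A B p =
          (1 / 2 : ℝ) • (mlieBracket I.tangent A B p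
              - contractedBracket I.tangent (fun q => Γ q) A B p)
            + (1 / 4 : ℝ) • nijenhuisTorsion I.tangent (fun q => Γ q) A B p := by
  -- Finite dimension enters only through completeness.
  have : CompleteSpace E := FiniteDimensional.complete ℝ E
  exact ⟨hΓ.lieAlgebroid, fun _ => rfl, fun _ _ _ => rfl⟩
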